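/- Let $G$ be a plabic graph: a non-empty finite planar graph (loops and multiple edges allowed), embedded in a closed disk, whose interior vertices are coloured black or white and have arbitrary positive degree (in particular trivalent graphs are covered), and whose boundary vertices $1,\dots,N$ ($N\ge 0$) have degree $1$ and lie in clockwise order on the boundary circle. Assume that every interior face of $G$ (a face not adjacent to the boundary circle) is simply connected. Let $c(G)$ be the number of connected components of $G$. Let $Q_G$ be the planar dual directed graph. Its vertices are the interior faces of $G$; each edge of $G$ whose endpoints have different colours and whose two sides are both interior faces gives one arrow between these two faces, directed so that the white endpoint is on the left of the arrow. Let $B(Q_G)=(b_{ij})$, $b_{ij}=\#\{\text{arrows } i\to j\}-\#\{\text{arrows } j\to i\}$, be its exchange matrix, and $\operatorname{cork}(Q_G)=n-\operatorname{rk}B(Q_G)$, where $n$ is the number of interior faces. A strand of $G$ is a path that makes a sharp right turn at each black vertex and a sharp left turn at each white vertex; at each boundary vertex, the incoming strand is joined with the outgoing strand. This turns the strands into a family of closed curves. Let $D$ be any drawing of these closed curves as an oriented divide in the disk $\mathbf D=\{x\in\mathbb C:|x|\le 1\}$, i.e. as immersed closed oriented curves all of whose double points are transversal and lie in the interior of $\mathbf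 D$ (for example, the curves drawn along the edges of $G$). Let $L^{\mathrm{plab}}_G=L_D$ be its link in $S^3=(\mathbf D\times S^1)/\!\sim$ (where $\sim$ collapses each circle $\{x\}\times S^1$ with $|x|=1$ to a point), obtained by lifting each point of $D$ to the argument of its tangent vector there. Let $c(L^{\mathrm{plab}}_G)$ be the number of connected components of this link. Then $$c(G)+\operatorname{cork}(Q_G)=c(L^{\mathrm{plab}}_G).$$ -/

import Mathlib

/-- The two colours of the interior vertices of a plabic graph. -/
inductive VertexColor
  | black
  | white

/-- A finite graph (loops and multiple edges are allowed), each edge consisting of two half-edges,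
with coloured interior vertices, with `N` boundary vertices of degree one, and with the clockwise
cyclic order of the half-edges at each vertex. A half-edge `h` is also read as the oriented edge
that leaves its vertex `src h` and ends at `src (opp h)`. -/
structure RibbonGraph where
  /-- interior vertices -/
  V : Type
  /-- half-edges -/
  H : Type
  /-- number of boundary vertices; these are `Fin N` -/
  N : ℕ
  finite_H : Finite H
  nonempty_H : Nonempty H
  color : V → VertexColor
  /-- the vertex at which a half-edge is attached -/
  src : H → V ⊕ Fin N
  src_surjective : Function.Surjective src
  /-- the other half of the same edge -/
  opp : H → H
  opp_opp : ∀ h, opp (opp h) = h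
  opp_ne : ∀ h, opp h ≠ h
  /-- the next half-edge in clockwise order around the same vertex -/
  rot : Equiv.Perm H
  src_eq_iff : ∀ h h', src h = src h' ↔ rot.SameCycle h h'
  /-- the only half-edge at a boundary vertex -/
  bdry : Fin N → H
  src_eq_inr : ∀ h i, src h = Sum.inr i ↔ h = bdry i

namespace RibbonGraph

/-- The vertices of the graph, interior ones and boundary ones. -/
abbrev Vertex (G : RibbonGraph) : Type := G.V ⊕ Fin G.N

/-- The connected components of the graph. -/
def Component (G : RibbonGraph) : Type :=
  Quot (fun v w : G.Vertex => ∃ h : G.H, G.src h = v ∧ G.src (G.opp h) = w)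

/-- The number of connected components of the graph. -/
noncomputable def numComponents (G : RibbonGraph) : ℕ := Nat.card G.Component

/-- The clockwise rotation of the graph drawn on the sphere that arises from the disk when its
boundary circle is collapsed to one point. All boundary vertices become one vertex; since they are
numbered clockwise along the circle as seen from inside the disk, they appear in decreasing order
clockwise around the new vertex. -/
def sphereRot (G : RibbonGraph) (h : G.H) : G.H :=
  match G.src h with
  | Sum.inl _ => G.rot h
  | Sum.inr i => G.bdry ((finRotate G.N).symm i)

/-- The oriented edge that follows `h` when one walks around the face on the left of `h`: at an
interior vertex one turns sharp left; at the boundary vertex `i` one follows the boundary circle to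
the boundary vertex `i - 1` and there enters the disk again. -/
def faceNext (G : RibbonGraph) (h : G.H) : G.H := G.sphereRot (G.opp h)

/-- Vertices on the sphere (those with at least one half-edge). -/
def SphereVertex (G : RibbonGraph) : Type := Quot (fun h h' : G.H => h' = G.sphereRot h)

/-- Edges. -/
def Edge (G : RibbonGraph) : Type := Quot (fun h h' : G.H => h' = G.opp h)

/-- Closed walks around faces. -/
def FaceWalk (G : RibbonGraph) : Type := Quot (fun h h' : G.H => h' = G.faceNext h)

/-- Connected components on the sphere, i.e. after the boundary vertices have been identified. -/
def SphereComponent (G : RibbonGraph) : Type :=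
  Quot (fun h h' : G.H => h' = G.sphereRot h ∨ h' = G.opp h)

/-- The face walk on the left of an oriented edge. -/
def walk (G : RibbonGraph) (h : G.H) : G.FaceWalk := Quot.mk _ h

/-- The component on the sphere that contains a half-edge. -/
def sphereComponent (G : RibbonGraph) (h : G.H) : G.SphereComponent := Quot.mk _ h

/-- Every component on the sphere has genus zero: `#V - #E + #F = 2 #C`. -/
def IsPlanar (G : RibbonGraph) : Prop :=
  Nat.card G.SphereVertex + Nat.card G.FaceWalk = Nat.card G.Edge + 2 * Nat.card G.SphereComponent

/-- The strand that runs along the oriented edge `h` makes a sharp right turn if `h` ends at a black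
vertex and a sharp left turn if it ends at a white vertex. A strand that arrives at a boundary
vertex is joined with the strand that leaves from that boundary vertex. -/
def strandNext (G : RibbonGraph) (h : G.H) : G.H :=
  match G.src (G.opp h) with
  | Sum.inl v =>
    match G.color v with
    | VertexColor.black => G.rot.symm (G.opp h)
    | VertexColor.white => G.rot (G.opp h)
  | Sum.inr _ => G.opp h

/-- The oriented edge `h` leads from a black vertex to a white vertex. -/
def IsBlackToWhite (G : RibbonGraph) (h : G.H) : Prop :=
  ∃ v w : G.V, G.src h = Sum.inl v ∧ G.color v = VertexColor.black ∧
    G.src (G.opp h) = Sum.inl w ∧ G.color w = VertexColor.white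

end RibbonGraph

/-- A plabic graph: a non-empty bicoloured graph embedded in a disk, with boundary vertices
`0, …, N - 1` in clockwise order on the boundary circle, whose interior faces are simply connected.
The embedding is recorded, up to orientation-preserving homeomorphism of the disk, by the rotation
system together with the faces. -/
structure PlabicGraph extends RibbonGraph where
  planar : toRibbonGraph.IsPlanar
  /-- the faces, i.e. the connected components of the complement of the graph in the disk -/
  Face : Type
  /-- the face on the left of an oriented edge -/
  left : H → Face
  left_surjective : Function.Surjective left
  left_faceNext : ∀ h, left (toRibbonGraph.faceNext h) = left h
  /-- the face is adjacent to the boundary circle of the disk -/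
  IsBoundaryFace : Face → Prop
  /-- If there are boundary vertices, then a face is adjacent to the circle if and only if it is
  adjacent to one of the arcs between consecutive boundary vertices. The arc that follows the
  boundary vertex `i` clockwise is next to the left side of `bdry i`. -/
  isBoundaryFace_iff : 0 < N → ∀ F, IsBoundaryFace F ↔ ∃ i, left (bdry i) = F
  /-- Without boundary vertices, exactly one face is adjacent to the circle. -/
  existsUnique_isBoundaryFace : N = 0 → ∃! F, IsBoundaryFace F
  /-- Interior faces are simply connected: they are bounded by a single closed walk. -/
  interior_simply_connected : ∀ h h', ¬ IsBoundaryFace (left h) → left h = left h' →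
    toRibbonGraph.walk h = toRibbonGraph.walk h'
  /-- Different face walks of one component (together with the circle, if the component meets it)
  bound different faces. -/
  walk_eq_of_left_eq : ∀ h h', toRibbonGraph.sphereComponent h = toRibbonGraph.sphereComponent h' →
    left h = left h' → toRibbonGraph.walk h = toRibbonGraph.walk h'
  /-- A component that does not meet the circle lies inside a boundary face of the rest of the
  graph, which is on the outer side of exactly one of the face walks of this component. -/
  existsUnique_outer_walk : ∀ h,
    (∀ i, toRibbonGraph.sphereComponent h ≠ toRibbonGraph.sphereComponent (bdry i)) →
    ∃! w : toRibbonGraph.FaceWalk, ∃ h',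
      toRibbonGraph.sphereComponent h' = toRibbonGraph.sphereComponent h ∧
      toRibbonGraph.walk h' = w ∧ IsBoundaryFace (left h')

namespace PlabicGraph

/-- The interior faces: those not adjacent to the boundary circle. -/
def InteriorFace (G : PlabicGraph) : Type := {F : G.Face // ¬ G.IsBoundaryFace F}

theorem finite_interiorFace (G : PlabicGraph) : Finite G.InteriorFace :=
  haveI := G.finite_H
  haveI : Finite G.Face := Finite.of_surjective G.left G.left_surjective
  Subtype.finite

instance (G : PlabicGraph) : Finite G.InteriorFace := G.finite_interiorFace

/-- The planar dual `Q_G` (a directed graph): its vertices are the interior faces; every edge of `G`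
with endpoints of different colours and both sides interior gives one arrow across this edge, with
the white endpoint on the left of the arrow. If `h` is this edge, oriented from black to white, then
the arrow leads from the left side of `h` to the right side of `h`. -/
instance dualQuiver (G : PlabicGraph) : Quiver.{0} G.InteriorFace where
  Hom F F' := {h : G.H // G.IsBlackToWhite h ∧ G.left h = F.1 ∧ G.left (G.opp h) = F'.1}

end PlabicGraph

/-- The exchange matrix of a directed graph:
`b i j = #{arrows i ⟶ j} - #{arrows j ⟶ i}`. -/
noncomputable def exchangeMatrix (Q : Type) [Quiver.{0} Q] : Matrix Q Q ℚ :=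
  fun i j => (Nat.card (i ⟶ j) : ℚ) - (Nat.card (j ⟶ i) : ℚ)

/-- The corank `n - rk B(Q)` of the exchange matrix of a directed graph with `n` vertices. -/
noncomputable def quiverCorank (Q : Type) [Quiver.{0} Q] [Finite Q] : ℕ :=
  letI := Fintype.ofFinite Q
  Nat.card Q - (exchangeMatrix Q).rank

/-- A drawing of the strands of `G`, joined at the boundary vertices, as an oriented divide in the
closed unit disk of `ℂ`. The part of a strand that runs along the oriented edge `h` is the oriented
`C¹` arc `pos h` on `[0, 1]`, with velocity `vel h`; it is continued, without a corner, by the arc of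
`strandNext h`. All double points are transversal and lie in the open disk. (When the strands are
drawn along `G`, the double points are one on each edge with endpoints of different colours; every
divide drawn from the joined strands is allowed here, so no condition on the number or the position
of the double points is imposed.) -/
structure StrandDivide (G : PlabicGraph) where
  pos : G.H → ℝ → ℂ
  vel : G.H → ℝ → ℂ
  hasDeriv : ∀ h, ∀ t ∈ Set.Icc (0 : ℝ) 1,
    HasDerivWithinAt (pos h) (vel h t) (Set.Icc 0 1) t
  continuous_vel : ∀ h, ContinuousOn (vel h) (Set.Icc 0 1)
  vel_ne_zero : ∀ h, ∀ t ∈ Set.Icc (0 : ℝ) 1, vel h t ≠ 0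
  norm_pos_le : ∀ h, ∀ t ∈ Set.Icc (0 : ℝ) 1, ‖pos h t‖ ≤ 1
  pos_one : ∀ h, pos h 1 = pos (G.strandNext h) 0
  vel_one : ∀ h, SameRay ℝ (vel h 1) (vel (G.strandNext h) 0)
  transversal : ∀ h h', ∀ s ∈ Set.Ico (0 : ℝ) 1, ∀ t ∈ Set.Ico (0 : ℝ) 1,
    (h, s) ≠ (h', t) → pos h s = pos h' t →
      ‖pos h s‖ < 1 ∧ LinearIndependent ℝ ![vel h s, vel h' t]

namespace StrandDivide

/-- The lift of a point of the divide to the 3-sphere. The quotient of `disk × S¹` that collapses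
every circle over a boundary point of the disk is identified with the unit sphere of `ℂ × ℂ` by
`(x, y) ↦ (x, √(1 - |x|²) y)`; the coordinate `y` is the direction of the divide. -/
noncomputable def lift {G : PlabicGraph} (D : StrandDivide G) (h : G.H) (t : ℝ) : ℂ × ℂ :=
  (D.pos h t, (Real.sqrt (1 - ‖D.pos h t‖ ^ 2) / ‖D.vel h t‖) • D.vel h t)

/-- The lift does lie on the unit sphere of `ℂ × ℂ`. -/
theorem lift_mem_sphere {G : PlabicGraph} (D : StrandDivide G) (h : G.H) {t : ℝ}
    (ht : t ∈ Set.Icc (0 : ℝ) 1) : ‖(D.lift h t).1‖ ^ 2 + ‖(D.lift h t).2‖ ^ 2 = 1 := by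
  have hv : ‖D.vel h t‖ ≠ 0 := norm_ne_zero_iff.mpr (D.vel_ne_zero h t ht)
  have h1 := D.norm_pos_le h t ht
  have h0 := norm_nonneg (D.pos h t)
  have hs : 0 ≤ 1 - ‖D.pos h t‖ ^ 2 := by nlinarith
  have hu : ‖(D.lift h t).2‖ = Real.sqrt (1 - ‖D.pos h t‖ ^ 2) := by
    simp only [lift, norm_smul, norm_div, Real.norm_eq_abs, abs_norm,
      abs_of_nonneg (Real.sqrt_nonneg _)]
    field_simp
  rw [hu, Real.sq_sqrt hs]
  simp [lift]

/-- The link of the divide, a subset of the 3-sphere. -/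
def link {G : PlabicGraph} (D : StrandDivide G) : Set (ℂ × ℂ) :=
  {p | ∃ h : G.H, ∃ t ∈ Set.Icc (0 : ℝ) 1, p = D.lift h t}

/-- The number of components of the link. -/
noncomputable def numLinkComponents {G : PlabicGraph} (D : StrandDivide G) : ℕ :=
  Nat.card (ConnectedComponents D.link)

end StrandDivide

/-! Both sides count closed strands, i.e. cycles of `strandNext`. For the graph side, the dimension
of one rational vector space, `compatiblePairs`, is computed twice. A pair consists of a face
function `a`, extended by zero to boundary faces, and a vertex function `k`; the gradient of `k`
along an edge is `edgeSign` times the sum of `a` over the two sides.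

Projection to `a`: over `a = 0` the function `k` is constant on components, which gives `c(G)`. A
given `a` occurs iff the prescribed gradient sums to zero around every interior face
(`exists_eq_sub_of_sum_left_eq_zero`). This sum is `(B a)_i`, because the signs themselves telescope
around a face (`exchangeMatrix_mulVec`). So the image is `ker B`, and the dimension is `c(G) +
cork`.

Strands: put `q = k - a(left)` on an oriented edge ending at a white or boundary vertex and `q = k +
a(right)` on one ending at a black vertex. A strand keeps its left face at a white turn and its
right face at a black turn, so `q` is constant along strands (`strandFunction_strandNext`).
Conversely, for any `q` constant on strands, the jump `q (opp h) - q h` is a flow without sources,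
hence the boundary of a face function `a`, and `k` can be solved for (`exists_strandFunction_eq`).

The topology of the disk enters through `exists_face_function_of_flow`, which rests on an Euler
characteristic count. On the link side, transversality separates the lifts of different strands
(`eq_of_lift_eq`), so the components of the link are the closed strands. -/

/-! ### Linear algebra: functions on quotients and orthogonal decompositions. -/

/-- The functions that are constant along a relation. -/
def relInvariant {X : Type} (r : X → X → Prop) : Submodule ℚ (X → ℚ) where
  carrier := {f | ∀ x y, r x y → f x = f y}
  add_mem' := fun hf hg x y h => by simp [hf x y h, hg x y h]
  zero_mem' := fun _ _ _ => rfl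
  smul_mem' := fun c f hf x y h => by simp [hf x y h]

/-- Functions that are constant along a relation are functions on the quotient. -/
def relInvariantEquiv {X : Type} (r : X → X → Prop) : relInvariant r ≃ₗ[ℚ] (Quot r → ℚ) where
  toFun f := Quot.lift f.1 f.2
  map_add' f g := by ext ⟨x⟩; rfl
  map_smul' c f := by ext ⟨x⟩; rfl
  invFun g := ⟨fun x => g (Quot.mk r x), fun x y h => by simp only [Quot.sound h]⟩
  left_inv f := rfl
  right_inv g := by ext ⟨x⟩; rfl

theorem finrank_relInvariant {X : Type} [Finite X] (r : X → X → Prop) :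
    Module.finrank ℚ (relInvariant r) = Nat.card (Quot r) := by
  have : Finite (Quot r) := Quot.finite r
  have := Fintype.ofFinite (Quot r)
  rw [(relInvariantEquiv r).finrank_eq, Module.finrank_fintype_fun_eq_card,
    Nat.card_eq_fintype_card]

/-- The dot product over `ℚ` is definite, so the sum of the three spaces is direct and by dimension
exhausts everything. Pairing `x` with its own components in `U₁` and `U₃` kills both. -/
theorem mem_of_orthogonal_of_finrank_add_eq {H : Type} [Fintype H]
    (U₁ U₂ U₃ : Submodule ℚ (H → ℚ))
    (h₁₂ : ∀ u ∈ U₁, ∀ v ∈ U₂, u ⬝ᵥ v = 0) (h₁₃ : ∀ u ∈ U₁, ∀ v ∈ U₃, u ⬝ᵥ v = 0)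
    (h₂₃ : ∀ u ∈ U₂, ∀ v ∈ U₃, u ⬝ᵥ v = 0)
    (hdim : Module.finrank ℚ U₁ + Module.finrank ℚ U₂ + Module.finrank ℚ U₃ = Fintype.card H)
    (x : H → ℚ) (hx₁ : ∀ u ∈ U₁, u ⬝ᵥ x = 0) (hx₃ : ∀ u ∈ U₃, u ⬝ᵥ x = 0) : x ∈ U₂ := by
  have key : ∀ (u₁ : U₁) (u₂ : U₂) (u₃ : U₃),
      (u₁ : H → ℚ) ⬝ᵥ ((u₁ : H → ℚ) + u₂ + u₃) = 0 →
      (u₃ : H → ℚ) ⬝ᵥ ((u₁ : H → ℚ) + u₂ + u₃) = 0 → u₁ = 0 ∧ u₃ = 0 := by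
    intro u₁ u₂ u₃ h1 h3
    rw [dotProduct_add, dotProduct_add, h₁₂ _ u₁.2 _ u₂.2, h₁₃ _ u₁.2 _ u₃.2, add_zero, add_zero,
      dotProduct_self_eq_zero] at h1
    rw [dotProduct_add, dotProduct_add, dotProduct_comm, h₁₃ _ u₁.2 _ u₃.2, zero_add,
      dotProduct_comm, h₂₃ _ u₂.2 _ u₃.2, zero_add, dotProduct_self_eq_zero] at h3
    exact ⟨Subtype.ext h1, Subtype.ext h3⟩
  let T : (U₁ × U₂ × U₃) →ₗ[ℚ] (H → ℚ) :=
    U₁.subtype.coprod (U₂.subtype.coprod U₃.subtype)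
  have hT : ∀ u, T u = (u.1 : H → ℚ) + u.2.1 + u.2.2 := fun u => by
    simp [T, add_assoc]
  have hinj : Function.Injective T := by
    rw [injective_iff_map_eq_zero]
    rintro ⟨u₁, u₂, u₃⟩ h
    rw [hT] at h
    obtain ⟨r1, r3⟩ := key u₁ u₂ u₃ (by simp only at h; simp [h]) (by simp only at h; simp [h])
    subst r1 r3
    have : u₂ = 0 := Subtype.ext (by simpa using h)
    simp [this]
  have hsurj : Function.Surjective T := by
    rw [← LinearMap.injective_iff_surjective_of_finrank_eq_finrank]
    · exact hinj
    · rw [Module.finrank_prod, Module.finrank_prod, Module.finrank_fintype_fun_eq_card,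
        ← hdim, add_assoc]
  obtain ⟨⟨u₁, u₂, u₃⟩, rfl⟩ := hsurj x
  rw [hT] at hx₁ hx₃ ⊢
  obtain ⟨r1, r3⟩ := key u₁ u₂ u₃ (hx₁ _ u₁.2) (hx₃ _ u₃.2)
  simp [r1, r3]

/-- The cyclic shift is transitive; this carries values from arc to arc along the boundary circle.
-/
theorem exists_eq_comp_finRotate_symm_invariant {N : ℕ} {β : Type} (g : Fin N → β)
    (hg : ∀ i, g ((finRotate N).symm i) = g i) (i j : Fin N) : g i = g j := by
  cases N with
  | zero => exact i.elim0
  | succ n =>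
    have h0 : ∀ i : Fin (n + 1), g i = g 0 := by
      intro i
      induction i using Fin.induction with
      | zero => rfl
      | succ i ih =>
        rw [← ih, ← hg i.succ]
        congr 1
        rw [Equiv.symm_apply_eq, finRotate_apply, Fin.coeSucc_eq_succ]
    rw [h0 i, h0 j]

/-! ### Rotation systems and their orbits. -/

namespace RibbonGraph

variable (G : RibbonGraph)

theorem opp_injective : Function.Injective G.opp :=
  Function.LeftInverse.injective G.opp_opp

/-- The involution that exchanges the two halves of every edge. -/
def oppEquiv : Equiv.Perm G.H := ⟨G.opp, G.opp, G.opp_opp, G.opp_opp⟩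

theorem src_rot (h : G.H) : G.src (G.rot h) = G.src h :=
  (G.src_eq_iff _ _).2 (Equiv.Perm.sameCycle_apply_left.2 (Equiv.Perm.SameCycle.refl _ _))

theorem src_rot_symm (h : G.H) : G.src (G.rot.symm h) = G.src h := by
  rw [← G.src_rot, Equiv.apply_symm_apply]

theorem src_bdry (i : Fin G.N) : G.src (G.bdry i) = Sum.inr i := (G.src_eq_inr _ _).2 rfl

theorem rot_of_src_eq_inr {h : G.H} {i : Fin G.N} (hi : G.src h = Sum.inr i) : G.rot h = h := by
  rw [(G.src_eq_inr _ _).1 hi]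
  exact (G.src_eq_inr _ _).1 (by rw [src_rot, src_bdry])

theorem sphereRot_of_src_eq_inl {h : G.H} {v : G.V} (hv : G.src h = Sum.inl v) :
    G.sphereRot h = G.rot h := by
  simp only [sphereRot, hv]

theorem sphereRot_of_src_eq_inr {h : G.H} {i : Fin G.N} (hi : G.src h = Sum.inr i) :
    G.sphereRot h = G.bdry ((finRotate G.N).symm i) := by
  simp only [sphereRot, hi]

theorem sphereRot_injective : Function.Injective G.sphereRot := by
  intro h h' e
  rcases hs : G.src h with v | i <;> rcases hs' : G.src h' with v' | i'
  · rw [sphereRot_of_src_eq_inl _ hs, sphereRot_of_src_eq_inl _ hs'] at e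
    exact G.rot.injective e
  · rw [sphereRot_of_src_eq_inl _ hs, sphereRot_of_src_eq_inr _ hs'] at e
    have := congrArg G.src e
    rw [src_rot, hs, src_bdry] at this
    cases this
  · rw [sphereRot_of_src_eq_inr _ hs, sphereRot_of_src_eq_inl _ hs'] at e
    have := congrArg G.src e
    rw [src_rot, hs', src_bdry] at this
    cases this
  · rw [sphereRot_of_src_eq_inr _ hs, sphereRot_of_src_eq_inr _ hs'] at e
    have := congrArg G.src e
    rw [src_bdry, src_bdry, Sum.inr.injEq, (finRotate G.N).symm.injective.eq_iff] at this
    rw [(G.src_eq_inr _ _).1 hs, (G.src_eq_inr _ _).1 hs', this]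

theorem sphereRot_bijective : Function.Bijective G.sphereRot :=
  have := G.finite_H
  Finite.injective_iff_bijective.1 G.sphereRot_injective

theorem faceNext_bijective : Function.Bijective G.faceNext :=
  G.sphereRot_bijective.comp G.oppEquiv.bijective

theorem faceNext_opp (h : G.H) : G.faceNext (G.opp h) = G.sphereRot h := by
  rw [faceNext, opp_opp]

/-- Vertices are exactly the cycles of `rot`. -/
theorem exists_eq_comp_src {β : Type} (f : G.H → β) (hf : ∀ h, f (G.rot h) = f h) :
    ∃ k : G.Vertex → β, ∀ h, f h = k (G.src h) := by
  have hz : ∀ (n : ℤ) (h : G.H), f ((G.rot ^ n) h) = f h := by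
    intro n
    induction n using Int.induction_on with
    | zero => simp
    | succ n ih => intro h; rw [zpow_add_one, Equiv.Perm.mul_apply, ih, hf]
    | pred n ih =>
      intro h
      rw [zpow_sub_one, Equiv.Perm.mul_apply, ih]
      have e := hf (G.rot.symm h)
      rw [Equiv.apply_symm_apply] at e
      exact e.symm
  choose c hc using G.src_surjective
  refine ⟨fun v => f (c v), fun h => ?_⟩
  obtain ⟨n, hn⟩ := (G.src_eq_iff _ _).1 (hc (G.src h)).symm
  dsimp only
  rw [← hn, hz]

theorem finite_vertex : Finite G.Vertex :=
  have := G.finite_H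
  Finite.of_surjective _ G.src_surjective

theorem sphereComponent_opp (h : G.H) : G.sphereComponent (G.opp h) = G.sphereComponent h :=
  (Quot.sound (r := fun h h' : G.H => h' = G.sphereRot h ∨ h' = G.opp h) (Or.inr rfl)).symm

theorem sphereComponent_sphereRot (h : G.H) :
    G.sphereComponent (G.sphereRot h) = G.sphereComponent h :=
  (Quot.sound (r := fun h h' : G.H => h' = G.sphereRot h ∨ h' = G.opp h) (Or.inl rfl)).symm

theorem sphereComponent_faceNext (h : G.H) :
    G.sphereComponent (G.faceNext h) = G.sphereComponent h := by
  rw [faceNext, sphereComponent_sphereRot, sphereComponent_opp]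

theorem sphereComponent_bdry (i j : Fin G.N) :
    G.sphereComponent (G.bdry i) = G.sphereComponent (G.bdry j) := by
  refine exists_eq_comp_finRotate_symm_invariant (fun i => G.sphereComponent (G.bdry i)) ?_ i j
  intro i
  rw [← G.sphereRot_of_src_eq_inr (G.src_bdry i), sphereComponent_sphereRot]

theorem apply_eq_of_walk_eq {β : Type} {f : G.H → β} (hf : ∀ h, f (G.faceNext h) = f h)
    {h h' : G.H} (e : G.walk h = G.walk h') : f h = f h' := by
  have := congrArg (Quot.lift f (fun a b hab => by rw [hab, hf])) e
  exact this

theorem apply_eq_of_sphereComponent_eq {β : Type} {f : G.H → β}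
    (hf : ∀ h, f (G.sphereRot h) = f h) (ho : ∀ h, f (G.opp h) = f h)
    {h h' : G.H} (e : G.sphereComponent h = G.sphereComponent h') : f h = f h' := by
  have := congrArg (Quot.lift f (fun a b hab => by
    rcases hab with hab | hab
    · rw [hab, hf]
    · rw [hab, ho])) e
  exact this

end RibbonGraph
-- Flows and gradients on a surface of genus zero.
namespace RibbonGraph

variable (G : RibbonGraph)

/-- The difference of the values on the two halves of each edge. -/
def edgeDiff : (G.H → ℚ) →ₗ[ℚ] (G.H → ℚ) where
  toFun f h := f h - f (G.opp h)
  map_add' f g := by ext h; simp only [Pi.add_apply]; ring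
  map_smul' c f := by ext h; simp only [Pi.smul_apply, smul_eq_mul, RingHom.id_apply]; ring

theorem edgeDiff_apply (f : G.H → ℚ) (h : G.H) : G.edgeDiff f h = f h - f (G.opp h) := rfl

/-- The functions that take equal values on the two halves of each edge. -/
def edgeSymm : Submodule ℚ (G.H → ℚ) := relInvariant (fun h h' : G.H => h' = G.opp h)

theorem mem_edgeSymm {f : G.H → ℚ} : f ∈ G.edgeSymm ↔ ∀ h, f (G.opp h) = f h :=
  ⟨fun hf h => (hf h _ rfl).symm, fun hf h h' e => by rw [e, hf]⟩

theorem mem_relInvariant_fun {X : Type} {φ : X → X} {f : X → ℚ} :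
    f ∈ relInvariant (fun x y => y = φ x) ↔ ∀ x, f (φ x) = f x :=
  ⟨fun hf h => (hf h _ rfl).symm, fun hf h h' e => by rw [e, hf]⟩

/-- Rank-nullity: the kernel of `edgeDiff` on `φ`-invariant functions consists of the functions on
sphere components. The form with a general `φ` serves both vertices (`sphereRot`) and face walks
(`faceNext`). -/
theorem finrank_map_edgeDiff_add (φ : G.H → G.H)
    (hφ : ∀ f : G.H → ℚ, (∀ h, f (G.opp h) = f h) →
      ((∀ h, f (φ h) = f h) ↔ ∀ h, f (G.sphereRot h) = f h)) :
    Module.finrank ℚ ((relInvariant (fun h h' : G.H => h' = φ h)).map G.edgeDiff)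
      + Nat.card G.SphereComponent
      = Nat.card (Quot (fun h h' : G.H => h' = φ h)) := by
  have := G.finite_H
  rw [SphereComponent, ← finrank_relInvariant, ← finrank_relInvariant]
  set I := relInvariant (fun h h' : G.H => h' = φ h)
  have e := (G.edgeDiff.domRestrict I).finrank_range_add_finrank_ker
  rw [LinearMap.range_domRestrict] at e
  rw [← e, add_right_inj]
  refine LinearEquiv.finrank_eq (LinearEquiv.symm ?_)
  have hmem : ∀ f : I, f ∈ LinearMap.ker (G.edgeDiff.domRestrict I) ↔
      (f : G.H → ℚ) ∈ relInvariant (fun h h' : G.H => h' = G.sphereRot h ∨ h' = G.opp h) := by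
    rintro ⟨f, hf⟩
    rw [mem_relInvariant_fun] at hf
    rw [LinearMap.mem_ker, LinearMap.domRestrict_apply]
    constructor
    · intro h0
      have ho : ∀ h, f (G.opp h) = f h := fun h => by
        have := congrFun h0 h
        rw [edgeDiff_apply, Pi.zero_apply, sub_eq_zero] at this
        exact this.symm
      have hs := (hφ f ho).1 hf
      rintro h h' (r | r)
      · exact r ▸ (hs h).symm
      · exact r ▸ (ho h).symm
    · intro hi
      ext h
      rw [edgeDiff_apply, Pi.zero_apply, sub_eq_zero]
      exact hi _ _ (Or.inr rfl)
  refine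
    { toFun := fun f => ⟨f.1.1, (hmem f.1).1 f.2⟩
      map_add' := fun _ _ => rfl
      map_smul' := fun _ _ => rfl
      invFun := fun f => ⟨⟨f.1, ?_⟩, ?_⟩
      left_inv := fun _ => rfl
      right_inv := fun _ => rfl }
  · rw [mem_relInvariant_fun, hφ]
    · exact fun h => (f.2 _ _ (Or.inl rfl)).symm
    · exact fun h => (f.2 _ _ (Or.inr rfl)).symm
  · exact (hmem _).2 f.2

theorem edgeDiff_eq_two_smul {x : G.H → ℚ} (hx : ∀ h, x (G.opp h) = - x h) :
    G.edgeDiff x = (2 : ℚ) • x := by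
  ext h
  rw [edgeDiff_apply, hx, Pi.smul_apply, smul_eq_mul]
  ring

theorem edgeDiff_opp (f : G.H → ℚ) (h : G.H) : G.edgeDiff f (G.opp h) = - G.edgeDiff f h := by
  rw [edgeDiff_apply, edgeDiff_apply, opp_opp]
  ring

variable [Fintype G.H]

theorem sum_opp (f : G.H → ℚ) : ∑ h, f (G.opp h) = ∑ h, f h :=
  Equiv.sum_comp G.oppEquiv f

theorem edgeDiff_dotProduct (f x : G.H → ℚ) : G.edgeDiff f ⬝ᵥ x = f ⬝ᵥ G.edgeDiff x := by
  simp only [dotProduct, edgeDiff_apply, sub_mul, mul_sub, Finset.sum_sub_distrib]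
  rw [sub_right_inj, ← G.sum_opp]
  simp only [opp_opp]

theorem dotProduct_edgeSymm {x s : G.H → ℚ} (hx : ∀ h, x (G.opp h) = - x h)
    (hs : ∀ h, s (G.opp h) = s h) : x ⬝ᵥ s = 0 := by
  have h1 : G.edgeDiff s = 0 := by
    ext h
    rw [edgeDiff_apply, hs, sub_self, Pi.zero_apply]
  have h2 := G.edgeDiff_dotProduct x s
  rw [h1, dotProduct_zero, edgeDiff_eq_two_smul _ hx, smul_dotProduct, smul_eq_mul] at h2
  linarith

theorem card_eq_two_mul_card_edge : Fintype.card G.H = 2 * Nat.card G.Edge := by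
  classical
  have : Finite G.Edge := Quot.finite _
  have := Fintype.ofFinite G.Edge
  let f : G.H → G.Edge := Quot.mk _
  rw [Nat.card_eq_fintype_card, mul_comm, ← Finset.card_univ, ← Finset.card_univ,
    Finset.card_eq_sum_card_fiberwise (f := f) (t := (Finset.univ : Finset G.Edge))
      (fun _ _ => Finset.mem_coe.2 (Finset.mem_univ _))]
  refine Finset.sum_const_nat fun e _ => ?_
  obtain ⟨h, rfl⟩ := Quot.exists_rep e
  rw [Finset.card_eq_two]
  refine ⟨h, G.opp h, (G.opp_ne h).symm, ?_⟩
  ext g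
  rw [Finset.mem_filter, Finset.mem_insert, Finset.mem_singleton]
  constructor
  · rintro ⟨-, e⟩
    have e' := congrArg (Quot.lift (fun h => ({h, G.opp h} : Finset G.H)) (fun a b hab => by
      rw [hab, opp_opp, Finset.pair_comm])) e
    have e' : ({g, G.opp g} : Finset G.H) = {h, G.opp h} := e'
    have hg : g ∈ ({h, G.opp h} : Finset G.H) := by
      rw [← e']
      exact Finset.mem_insert_self _ _
    rwa [Finset.mem_insert, Finset.mem_singleton] at hg
  · rintro (rfl | rfl)
    · exact ⟨Finset.mem_univ _, rfl⟩
    · exact ⟨Finset.mem_univ _, (Quot.sound (r := fun h h' : G.H => h' = G.opp h) rfl).symm⟩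

/-- A flow on the sphere without sources and sinks is the boundary of a function on the faces, since
every component has genus zero. -/
theorem exists_faceNext_invariant_of_flow (hG : G.IsPlanar) (x : G.H → ℚ)
    (hx : ∀ h, x (G.opp h) = - x h)
    (hflow : ∀ f : G.H → ℚ, (∀ h, f (G.sphereRot h) = f h) → f ⬝ᵥ x = 0) :
    ∃ y : G.H → ℚ, (∀ h, y (G.faceNext h) = y h) ∧ ∀ h, x h = y h - y (G.opp h) := by
  have hmem := mem_of_orthogonal_of_finrank_add_eq
    ((relInvariant (fun h h' : G.H => h' = G.sphereRot h)).map G.edgeDiff)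
    ((relInvariant (fun h h' : G.H => h' = G.faceNext h)).map G.edgeDiff)
    G.edgeSymm ?_ ?_ ?_ ?_ x ?_ ?_
  · obtain ⟨y, hy, rfl⟩ := hmem
    exact ⟨y, mem_relInvariant_fun.1 hy, fun h => rfl⟩
  · rintro _ ⟨f, hf, rfl⟩ _ ⟨y, hy, rfl⟩
    have hf := mem_relInvariant_fun.1 hf
    have hy := mem_relInvariant_fun.1 hy
    rw [edgeDiff_dotProduct, G.edgeDiff_eq_two_smul (G.edgeDiff_opp y), dotProduct_smul]
    -- The boundary of a face walk has no sources: `y (opp h)` equals `y (sphereRot h)`, so the two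
    -- sums agree after reindexing by `sphereRot`.
    have : f ⬝ᵥ G.edgeDiff y = 0 := by
      simp only [dotProduct, edgeDiff_apply, mul_sub, Finset.sum_sub_distrib]
      rw [sub_eq_zero, ← G.sphereRot_bijective.sum_comp (fun h => f h * y h)]
      refine Finset.sum_congr rfl fun h _ => ?_
      rw [hf, ← G.faceNext_opp, hy]
    rw [this, smul_zero]
  · rintro _ ⟨f, hf, rfl⟩ s hs
    exact G.dotProduct_edgeSymm (G.edgeDiff_opp f) (G.mem_edgeSymm.1 hs)
  · rintro _ ⟨f, hf, rfl⟩ s hs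
    exact G.dotProduct_edgeSymm (G.edgeDiff_opp f) (G.mem_edgeSymm.1 hs)
  -- The dimensions are `#V - #C`, `#F - #C` and `#E`; genus zero makes their sum `2 #E`, the number
  -- of half-edges.
  · have h1 := G.finrank_map_edgeDiff_add G.sphereRot (fun f _ => Iff.rfl)
    have h2 := G.finrank_map_edgeDiff_add G.faceNext (fun f ho => by
      constructor
      · intro hf h
        rw [← faceNext_opp, hf, ho]
      · intro hf h
        rw [faceNext, hf, ho])
    have h3 := finrank_relInvariant (fun h h' : G.H => h' = G.opp h)
    have h4 := G.card_eq_two_mul_card_edge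
    have h5 : Nat.card G.SphereVertex + Nat.card G.FaceWalk = _ := hG
    rw [edgeSymm]
    rw [SphereVertex, FaceWalk] at h5
    rw [Edge] at h4 h5
    omega
  · rintro _ ⟨f, hf, rfl⟩
    rw [edgeDiff_dotProduct, G.edgeDiff_eq_two_smul hx, dotProduct_smul,
      hflow f (mem_relInvariant_fun.1 hf), smul_zero]
  · intro s hs
    rw [dotProduct_comm]
    exact G.dotProduct_edgeSymm hx (G.mem_edgeSymm.1 hs)

/-- A flow without sources and sinks vanishes along boundary edges. -/
theorem flow_bdry {x : G.H → ℚ} (hflow : ∀ k : G.Vertex → ℚ, ∑ h, k (G.src h) * x h = 0)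
    (i : Fin G.N) : x (G.bdry i) = 0 := by
  classical
  -- Only one half-edge starts at a boundary vertex, so conservation there involves a single term.
  rw [← hflow (fun v => if v = Sum.inr i then 1 else 0)]
  simp only [src_eq_inr, ite_mul, one_mul, zero_mul, Finset.sum_ite_eq', Finset.mem_univ, if_true]

/-- Collapsing the circle only merges boundary vertices, so a flow in the disk remains a flow on the
sphere. -/
theorem dotProduct_flow_of_sphereRot_invariant {x : G.H → ℚ}
    (hflow : ∀ k : G.Vertex → ℚ, ∑ h, k (G.src h) * x h = 0)
    {f : G.H → ℚ} (hf : ∀ h, f (G.sphereRot h) = f h) : f ⬝ᵥ x = 0 := by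
  have hr : ∀ h, f (G.rot h) = f h := by
    intro h
    rcases hs : G.src h with v | i
    · rw [← G.sphereRot_of_src_eq_inl hs, hf]
    · rw [G.rot_of_src_eq_inr hs]
  obtain ⟨k, hk⟩ := G.exists_eq_comp_src f hr
  simp only [dotProduct, hk, hflow]

/-- A function on oriented edges that is orthogonal to all flows is a gradient. -/
theorem exists_eq_sub_of_orthogonal_flow {z : G.H → ℚ} (hz : ∀ h, z (G.opp h) = - z h)
    (horth : ∀ x : G.H → ℚ, (∀ h, x (G.opp h) = - x h) →
      (∀ k : G.Vertex → ℚ, ∑ h, k (G.src h) * x h = 0) → x ⬝ᵥ z = 0) :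
    ∃ k : G.Vertex → ℚ, ∀ h, z h = k (G.src (G.opp h)) - k (G.src h) := by
  classical
  let B : LinearMap.BilinForm ℚ (G.H → ℚ) := dotProductBilin ℚ ℚ
  have hB : ∀ f g, B f g = f ⬝ᵥ g := fun f g => rfl
  -- Everything orthogonal to `W` is an antisymmetric flow, so `z` lies in the double orthogonal of
  -- `W`, which is `W`; antisymmetry of `z` then removes the symmetric part.
  let W : Submodule ℚ (G.H → ℚ) :=
    (relInvariant (fun h h' : G.H => h' = G.rot h)).map G.edgeDiff ⊔ G.edgeSymm
  have hrefl : B.IsRefl := fun f g e => by rw [hB] at e ⊢; rwa [dotProduct_comm]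
  have hnd : B.Nondegenerate := by
    constructor
    · intro f hf
      exact dotProduct_self_eq_zero.1 (hf f)
    · intro f hf
      exact dotProduct_self_eq_zero.1 (hf f)
  have hmem : z ∈ B.orthogonal (B.orthogonal W) := by
    intro x hx
    have hxW : ∀ w ∈ W, w ⬝ᵥ x = 0 := hx
    have hxo : ∀ h, x (G.opp h) = - x h := by
      intro h
      have := hxW (Pi.single h 1 + Pi.single (G.opp h) 1) (Submodule.mem_sup_right ?_)
      · rw [add_dotProduct, single_dotProduct, single_dotProduct, one_mul, one_mul] at this
        linarith
      · rw [mem_edgeSymm]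
        intro g
        simp only [Pi.add_apply, Pi.single_apply, G.opp_injective.eq_iff]
        rw [add_comm]
        congr 2
        rw [← G.opp_injective.eq_iff, opp_opp]
    refine horth x hxo fun k => ?_
    have := hxW (G.edgeDiff (fun h => k (G.src h))) (Submodule.mem_sup_left ?_)
    · rw [edgeDiff_dotProduct, G.edgeDiff_eq_two_smul hxo, dotProduct_smul, smul_eq_mul] at this
      have h2 : (fun h => k (G.src h)) ⬝ᵥ x = 0 := by linarith
      exact h2
    · exact Submodule.mem_map_of_mem (mem_relInvariant_fun.2 fun h => by rw [src_rot])
  rw [LinearMap.BilinForm.orthogonal_orthogonal hnd hrefl, Submodule.mem_sup] at hmem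
  obtain ⟨_, ⟨f, hf, rfl⟩, s, hs, rfl⟩ := hmem
  obtain ⟨k, hk⟩ := G.exists_eq_comp_src f (mem_relInvariant_fun.1 hf)
  -- `edgeDiff` is start minus end, the gradient is end minus start; hence the sign.
  refine ⟨fun v => - k v, fun h => ?_⟩
  have h1 := hz h
  rw [Pi.add_apply, Pi.add_apply, edgeDiff_opp, G.mem_edgeSymm.1 hs] at h1
  have h2 : s h = 0 := by linarith
  rw [Pi.add_apply, h2, edgeDiff_apply, hk, hk]
  ring

end RibbonGraph
-- The turning rule of strands.
namespace RibbonGraph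

variable (G : RibbonGraph)

/-- `1` at white vertices and at boundary vertices, `0` at black vertices. -/
def whiteIndicator : G.Vertex → ℚ
  | Sum.inl v =>
    match G.color v with
    | VertexColor.black => 0
    | VertexColor.white => 1
  | Sum.inr _ => 1

/-- The next edge starts at the vertex where `h` ends, so it determines which turn was made, and
each turn is invertible. -/
theorem strandNext_injective : Function.Injective G.strandNext := by
  have hsrc : ∀ h, G.src (G.strandNext h) = G.src (G.opp h) := by
    intro h
    unfold strandNext
    split
    · split
      · exact G.src_rot_symm _
      · exact G.src_rot _
    · rfl
  intro h h' e
  have es := congrArg G.src e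
  rw [hsrc, hsrc] at es
  simp only [strandNext, es] at e
  split at e
  · split at e
    · exact G.opp_injective (G.rot.symm.injective e)
    · exact G.opp_injective (G.rot.injective e)
  · exact G.opp_injective e

theorem strandNext_bijective : Function.Bijective G.strandNext :=
  have := G.finite_H
  Finite.injective_iff_bijective.1 G.strandNext_injective

/-- At a vertex, the strand turns left, as face walks do, or right. -/
theorem strandNext_cases (h : G.H) :
    (G.whiteIndicator (G.src (G.opp h)) = 1 ∧ G.strandNext h = G.rot (G.opp h)) ∨
    (G.whiteIndicator (G.src (G.opp h)) = 0 ∧ G.strandNext h = G.rot.symm (G.opp h) ∧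
      ∃ v, G.src (G.opp h) = Sum.inl v) := by
  rcases hs : G.src (G.opp h) with v | i
  · rcases hc : G.color v
    · exact Or.inr ⟨by simp [whiteIndicator, hc], by simp [strandNext, hs, hc], v, rfl⟩
    · exact Or.inl ⟨by simp [whiteIndicator, hc], by simp [strandNext, hs, hc]⟩
  · exact Or.inl ⟨rfl, by rw [G.rot_of_src_eq_inr hs]; simp [strandNext, hs]⟩

theorem src_strandNext (h : G.H) : G.src (G.strandNext h) = G.src (G.opp h) := by
  rcases G.strandNext_cases h with ⟨-, e⟩ | ⟨-, e, -⟩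
  · rw [e, src_rot]
  · rw [e, src_rot_symm]

end RibbonGraph

/-! ### Faces, flows and gradients in the disk. -/

namespace PlabicGraph

variable (G : PlabicGraph)

theorem left_opp (h : G.H) : G.left (G.opp h) = G.left (G.sphereRot h) := by
  rw [← G.left_faceNext, G.faceNext_opp]

theorem left_rot_of_src_eq_inl {h : G.H} {v : G.V} (hv : G.src h = Sum.inl v) :
    G.left (G.rot h) = G.left (G.opp h) := by
  rw [left_opp, G.sphereRot_of_src_eq_inl hv]

theorem isBoundaryFace_left_bdry (i : Fin G.N) : G.IsBoundaryFace (G.left (G.bdry i)) :=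
  (G.isBoundaryFace_iff i.pos _).2 ⟨i, rfl⟩

theorem isBoundaryFace_left {h : G.H} {i : Fin G.N} (hi : G.src h = Sum.inr i) :
    G.IsBoundaryFace (G.left h) := by
  rw [(G.src_eq_inr _ _).1 hi]
  exact G.isBoundaryFace_left_bdry i

theorem isBoundaryFace_left_opp {h : G.H} {i : Fin G.N} (hi : G.src h = Sum.inr i) :
    G.IsBoundaryFace (G.left (G.opp h)) := by
  rw [left_opp, G.sphereRot_of_src_eq_inr hi]
  exact G.isBoundaryFace_left_bdry _

theorem exists_isBoundaryFace (h : G.H) :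
    ∃ h', G.sphereComponent h' = G.sphereComponent h ∧ G.IsBoundaryFace (G.left h') := by
  by_cases hm : ∀ i, G.sphereComponent h ≠ G.sphereComponent (G.bdry i)
  · obtain ⟨w, ⟨h', h1, -, h2⟩, -⟩ := G.existsUnique_outer_walk h hm
    exact ⟨h', h1, h2⟩
  · push Not at hm
    obtain ⟨i, hi⟩ := hm
    exact ⟨G.bdry i, hi.symm, G.isBoundaryFace_left_bdry i⟩

/-- Used to show that a potential on face walks has one outer value per component: either there is a
single outer walk, or all outer walks run past arcs of the circle. -/
theorem walk_eq_or_of_isBoundaryFace {h h' : G.H}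
    (e : G.sphereComponent h = G.sphereComponent h') (hb : G.IsBoundaryFace (G.left h))
    (hb' : G.IsBoundaryFace (G.left h')) :
    G.walk h = G.walk h' ∨
      ∃ i j, G.walk h = G.walk (G.bdry i) ∧ G.walk h' = G.walk (G.bdry j) := by
  by_cases hm : ∀ i, G.sphereComponent h ≠ G.sphereComponent (G.bdry i)
  · obtain ⟨w, -, hw⟩ := G.existsUnique_outer_walk h hm
    exact Or.inl ((hw _ ⟨h, rfl, rfl, hb⟩).trans (hw _ ⟨h', e.symm, rfl, hb'⟩).symm)
  · push Not at hm
    obtain ⟨i₀, hi₀⟩ := hm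
    obtain ⟨i, hi⟩ := (G.isBoundaryFace_iff i₀.pos _).1 hb
    obtain ⟨j, hj⟩ := (G.isBoundaryFace_iff i₀.pos _).1 hb'
    exact Or.inr ⟨i, j,
      G.walk_eq_of_left_eq _ _ (hi₀.trans (G.sphereComponent_bdry _ _)) hi.symm,
      G.walk_eq_of_left_eq _ _ ((e.symm.trans hi₀).trans (G.sphereComponent_bdry _ _)) hj.symm⟩

/-- A function on the faces that vanishes on boundary faces is determined by its differences along
the edges. -/
theorem eq_zero_of_left_eq_left_opp {a : G.Face → ℚ} (ha : ∀ F, G.IsBoundaryFace F → a F = 0)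
    (h0 : ∀ h, a (G.left h) = a (G.left (G.opp h))) (F : G.Face) : a F = 0 := by
  obtain ⟨h, rfl⟩ := G.left_surjective F
  obtain ⟨h', e, hb⟩ := G.exists_isBoundaryFace h
  rw [← ha _ hb]
  refine RibbonGraph.apply_eq_of_sphereComponent_eq G.toRibbonGraph
    (f := fun h => a (G.left h)) (fun h => ?_) (fun h => (h0 h).symm) e.symm
  rw [← left_opp, ← h0]

/-- Flows in the disk are boundaries of functions on the interior faces. -/
theorem exists_face_function_of_flow [Fintype G.H] (x : G.H → ℚ)
    (hx : ∀ h, x (G.opp h) = - x h)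
    (hflow : ∀ k : G.Vertex → ℚ, ∑ h, k (G.src h) * x h = 0) :
    ∃ a : G.Face → ℚ, (∀ F, G.IsBoundaryFace F → a F = 0) ∧
      ∀ h, x h = a (G.left h) - a (G.left (G.opp h)) := by
  classical
  obtain ⟨y, hy, hxy⟩ := G.exists_faceNext_invariant_of_flow G.planar x hx
    (fun f hf => G.dotProduct_flow_of_sphereRot_invariant hflow hf)
  -- No flow runs along a boundary edge, so `y` agrees on the two arcs next to each boundary vertex.
  have hbd : ∀ i j, y (G.bdry i) = y (G.bdry j) := by
    refine exists_eq_comp_finRotate_symm_invariant (fun i => y (G.bdry i)) fun i => ?_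
    have h1 := hxy (G.bdry i)
    rw [G.flow_bdry hflow, ← hy (G.opp _), G.faceNext_opp,
      G.sphereRot_of_src_eq_inr (G.src_bdry i)] at h1
    linarith
  have hout : ∀ h h', G.sphereComponent h = G.sphereComponent h' → G.IsBoundaryFace (G.left h) →
      G.IsBoundaryFace (G.left h') → y h = y h' := by
    intro h h' e hb hb'
    rcases G.walk_eq_or_of_isBoundaryFace e hb hb' with hw | ⟨i, j, hi, hj⟩
    · exact G.apply_eq_of_walk_eq hy hw
    · rw [G.apply_eq_of_walk_eq hy hi, G.apply_eq_of_walk_eq hy hj, hbd i j]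
  have hex : ∀ C : G.SphereComponent, ∃ h', G.sphereComponent h' = C ∧
      G.IsBoundaryFace (G.left h') := by
    rintro ⟨h⟩
    exact G.exists_isBoundaryFace h
  choose o ho hob using hex
  -- A boundary face may be bounded by walks of several components, on which `y` need not agree.
  -- Subtracting the outer value of each component makes the potential vanish there and so descend
  -- to faces, without changing differences across edges.
  let z : G.H → ℚ := fun h => y h - y (o (G.sphereComponent h))
  have hz0 : ∀ h, G.IsBoundaryFace (G.left h) → z h = 0 := fun h hb =>
    sub_eq_zero.2 (hout _ _ (ho _).symm hb (hob _))
  have hz : ∀ h, z (G.faceNext h) = z h := fun h => by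
    simp only [z, hy, G.sphereComponent_faceNext]
  have hzl : ∀ h h', G.left h = G.left h' → z h = z h' := by
    intro h h' e
    by_cases hb : G.IsBoundaryFace (G.left h)
    · rw [hz0 h hb, hz0 h' (e ▸ hb)]
    · exact G.apply_eq_of_walk_eq hz (G.interior_simply_connected _ _ hb e)
  choose c hc using G.left_surjective
  refine ⟨fun F => z (c F), fun F hF => hz0 _ (by rwa [hc]), fun h => ?_⟩
  dsimp only
  rw [hxy, hzl _ _ (hc (G.left h)), hzl _ _ (hc (G.left (G.opp h)))]
  simp only [z, G.sphereComponent_opp]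
  ring

/-- A gradient telescopes along the walk around an interior face, which passes no boundary vertex.
-/
theorem sum_left_eq_of_faceNext [Fintype G.H] [DecidableEq G.Face] {F : G.Face}
    (hF : ¬ G.IsBoundaryFace F) (k : G.Vertex → ℚ) :
    ∑ h, (if G.left h = F then k (G.src (G.opp h)) - k (G.src h) else 0) = 0 := by
  have h1 : ∀ h, (if G.left h = F then k (G.src (G.opp h)) - k (G.src h) else 0)
      = (if G.left h = F then k (G.src (G.opp h)) else 0)
        - (if G.left h = F then k (G.src h) else 0) := fun h => by split <;> simp
  simp only [h1, Finset.sum_sub_distrib]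
  rw [sub_eq_zero, eq_comm, ← G.faceNext_bijective.sum_comp]
  refine Finset.sum_congr rfl fun h _ => ?_
  rw [G.left_faceNext]
  split
  · next hl =>
    rcases hs : G.src (G.opp h) with v | i
    · rw [RibbonGraph.faceNext, G.sphereRot_of_src_eq_inl hs, G.src_rot, ← hs]
    · have := G.isBoundaryFace_left_opp hs
      rw [G.opp_opp, hl] at this
      exact absurd this hF
  · rfl

/-- A function on oriented edges is a gradient if its sum around every interior face is zero. -/
theorem exists_eq_sub_of_sum_left_eq_zero [Fintype G.H] [DecidableEq G.Face] {z : G.H → ℚ}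
    (hz : ∀ h, z (G.opp h) = - z h)
    (hsum : ∀ F, ¬ G.IsBoundaryFace F → ∑ h, (if G.left h = F then z h else 0) = 0) :
    ∃ k : G.Vertex → ℚ, ∀ h, z h = k (G.src (G.opp h)) - k (G.src h) := by
  have : Finite G.Face := Finite.of_surjective G.left G.left_surjective
  have := Fintype.ofFinite G.Face
  refine G.exists_eq_sub_of_orthogonal_flow hz fun x hx hflow => ?_
  obtain ⟨a, ha, hxa⟩ := G.exists_face_function_of_flow x hx hflow
  -- Summation by parts turns the pairing of `x` with `z` into twice the sum over faces of `a F`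
  -- times the circulation of `z` around `F`.
  have h1 : x = G.edgeDiff (fun h => a (G.left h)) := funext hxa
  have h2 : (fun h => a (G.left h)) ⬝ᵥ z = 0 := by
    have h3 : ∀ h, a (G.left h) * z h
        = ∑ F, a F * (if G.left h = F then z h else 0) := fun h => by simp
    simp only [dotProduct, h3]
    rw [Finset.sum_comm]
    refine Finset.sum_eq_zero fun F _ => ?_
    rw [← Finset.mul_sum]
    by_cases hF : G.IsBoundaryFace F
    · rw [ha F hF, zero_mul]
    · rw [hsum F hF, mul_zero]
  rw [h1, G.edgeDiff_dotProduct, G.edgeDiff_eq_two_smul hz, dotProduct_smul, h2, smul_zero]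

/-! ### The exchange matrix as a circulation around faces. -/

/-- Extension of a function on the interior faces by zero. -/
noncomputable def extendZero : (G.InteriorFace → ℚ) →ₗ[ℚ] (G.Face → ℚ) :=
  open Classical in
  { toFun := fun a F => if hF : G.IsBoundaryFace F then 0 else a ⟨F, hF⟩
    map_add' := fun a b => by
      ext F
      by_cases hF : G.IsBoundaryFace F
      · simp [hF]
      · simp only [dif_neg hF, Pi.add_apply]
        rfl
    map_smul' := fun c a => by
      ext F
      by_cases hF : G.IsBoundaryFace F
      · simp [hF]
      · simp only [dif_neg hF, Pi.smul_apply, RingHom.id_apply]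
        rfl }

theorem extendZero_of_isBoundaryFace (a : G.InteriorFace → ℚ) {F : G.Face}
    (hF : G.IsBoundaryFace F) : G.extendZero a F = 0 := by
  simp [extendZero, hF]

theorem extendZero_coe (a : G.InteriorFace → ℚ) (F : G.InteriorFace) :
    G.extendZero a F.1 = a F := by
  classical
  exact dif_neg F.2

theorem exists_extendZero_eq {b : G.Face → ℚ} (hb : ∀ F, G.IsBoundaryFace F → b F = 0) :
    ∃ a, G.extendZero a = b := by
  refine ⟨fun F => b F.1, ?_⟩
  ext F
  by_cases hF : G.IsBoundaryFace F
  · rw [extendZero_of_isBoundaryFace _ _ hF, hb F hF]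
  · exact G.extendZero_coe _ ⟨F, hF⟩

/-- `1` if the edge leads from black to white, `-1` if it leads from white to black. -/
def edgeSign (h : G.H) : ℚ :=
  G.whiteIndicator (G.src (G.opp h)) - G.whiteIndicator (G.src h)

theorem edgeSign_opp (h : G.H) : G.edgeSign (G.opp h) = - G.edgeSign h := by
  rw [edgeSign, edgeSign, G.opp_opp, neg_sub]

open Classical in
-- Boundary vertices count as white in `edgeSign` but not in `IsBlackToWhite`; edges ending at them
-- border only boundary faces, which `hl` excludes.
theorem edgeSign_eq {h : G.H} (hl : ¬ G.IsBoundaryFace (G.left h)) :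
    G.edgeSign h = (if G.IsBlackToWhite h then 1 else 0)
      - (if G.IsBlackToWhite (G.opp h) then 1 else 0) := by
  rcases hs : G.src h with v | i
  · rcases ht : G.src (G.opp h) with w | j
    · rcases hv : G.color v <;> rcases hw : G.color w <;>
        simp [edgeSign, RibbonGraph.whiteIndicator, RibbonGraph.IsBlackToWhite, G.opp_opp, hs, ht,
          hv, hw]
    · have := G.isBoundaryFace_left_opp ht
      rw [G.opp_opp] at this
      exact absurd this hl
  · exact absurd (G.isBoundaryFace_left hs) hl

open Classical in
theorem exchangeMatrix_apply [Fintype G.H] (i j : G.InteriorFace) :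
    exchangeMatrix G.InteriorFace i j
      = ∑ h, if G.left h = i.1 ∧ G.left (G.opp h) = j.1 then G.edgeSign h else 0 := by
  have hcard : ∀ i j : G.InteriorFace, (Nat.card (i ⟶ j) : ℚ)
      = ∑ h, if G.IsBlackToWhite h ∧ G.left h = i.1 ∧ G.left (G.opp h) = j.1 then 1 else 0 := by
    intro i j
    have : Nat.card (i ⟶ j)
      = Nat.card {h : G.H // G.IsBlackToWhite h ∧ G.left h = i.1 ∧ G.left (G.opp h) = j.1} := rfl
    rw [this, Nat.card_eq_fintype_card, Fintype.card_subtype, Finset.sum_boole]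
  rw [exchangeMatrix, hcard, hcard,
    ← G.sum_opp (fun h => if _ ∧ _ ∧ G.left (G.opp h) = i.1 then _ else _),
    ← Finset.sum_sub_distrib]
  refine Finset.sum_congr rfl fun h _ => ?_
  rw [G.opp_opp]
  by_cases hi : G.left h = i.1
  · by_cases hj : G.left (G.opp h) = j.1
    · rw [edgeSign_eq _ (by rw [hi]; exact i.2)]
      simp [hi, hj]
    · simp [hj]
  · simp [hi]

open Classical in
-- The term with `left h` contributes `a i` times the circulation of `edgeSign`, which is zero
-- because `edgeSign` is a gradient. Including it makes the summand antisymmetric under `opp`, as a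
-- gradient must be.
theorem exchangeMatrix_mulVec [Fintype G.H] [Fintype G.InteriorFace] (a : G.InteriorFace → ℚ)
    (i : G.InteriorFace) :
    (exchangeMatrix G.InteriorFace).mulVec a i
      = ∑ h, if G.left h = i.1 then G.edgeSign h *
          (G.extendZero a (G.left h) + G.extendZero a (G.left (G.opp h))) else 0 := by
  have h1 : ∀ h, (if G.left h = i.1 then G.edgeSign h *
      (G.extendZero a (G.left h) + G.extendZero a (G.left (G.opp h))) else 0)
      = a i * (if G.left h = i.1 then G.edgeSign h else 0)
        + ∑ j, (if G.left h = i.1 ∧ G.left (G.opp h) = j.1 then G.edgeSign h else 0) * a j := by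
    intro h
    by_cases hi : G.left h = i.1
    · have h2 : ∑ j : G.InteriorFace, (if G.left (G.opp h) = j.1 then G.edgeSign h else 0) * a j
          = G.edgeSign h * G.extendZero a (G.left (G.opp h)) := by
        by_cases hb : G.IsBoundaryFace (G.left (G.opp h))
        · rw [extendZero_of_isBoundaryFace _ _ hb, mul_zero]
          refine Finset.sum_eq_zero fun j _ => ?_
          have hj : G.left (G.opp h) ≠ j.1 := fun e => j.2 (e ▸ hb)
          rw [if_neg hj, zero_mul]
        · let j₀ : G.InteriorFace := ⟨_, hb⟩
          rw [Finset.sum_eq_single_of_mem j₀ (Finset.mem_univ _)]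
          · rw [if_pos rfl, ← G.extendZero_coe a j₀]
          · intro j _ hj
            have hj' : G.left (G.opp h) ≠ j.1 := fun e => hj (Subtype.ext e.symm)
            rw [if_neg hj', zero_mul]
      simp only [hi, true_and, if_true, h2, extendZero_coe]
      ring
    · simp [hi]
  simp only [h1, Finset.sum_add_distrib, ← Finset.mul_sum]
  have h3 := G.sum_left_eq_of_faceNext i.2 G.whiteIndicator
  simp only [edgeSign]
  rw [h3, mul_zero, zero_add, Finset.sum_comm]
  simp only [Matrix.mulVec, dotProduct, exchangeMatrix_apply, Finset.sum_mul, edgeSign]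

end PlabicGraph
-- Compatible pairs and the corank.
namespace PlabicGraph

variable (G : PlabicGraph)

/-- Pairs of a function on the interior faces and a function on the vertices whose gradient along
each edge with endpoints of different colours is, up to sign, the sum of the values on both sides. -/
def compatiblePairs : Submodule ℚ ((G.InteriorFace → ℚ) × (G.Vertex → ℚ)) where
  carrier := {p | ∀ h, p.2 (G.src (G.opp h)) - p.2 (G.src h)
    = G.edgeSign h * (G.extendZero p.1 (G.left h) + G.extendZero p.1 (G.left (G.opp h)))}
  add_mem' := fun {p q} hp hq h => by
    simp only [Prod.fst_add, Prod.snd_add, map_add, Pi.add_apply]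
    linear_combination hp h + hq h
  zero_mem' := fun h => by simp
  smul_mem' := fun c p hp h => by
    simp only [Prod.smul_fst, Prod.smul_snd, map_smul, Pi.smul_apply, smul_eq_mul]
    linear_combination c * hp h

theorem map_fst_compatiblePairs [Fintype G.InteriorFace] :
    G.compatiblePairs.map (LinearMap.fst ℚ _ _)
      = LinearMap.ker (exchangeMatrix G.InteriorFace).mulVecLin := by
  classical
  have := G.finite_H
  have := Fintype.ofFinite G.H
  ext a
  rw [LinearMap.mem_ker, Matrix.mulVecLin_apply]
  constructor
  · rintro ⟨⟨a, k⟩, hp, rfl⟩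
    ext i
    rw [LinearMap.fst_apply, exchangeMatrix_mulVec, Pi.zero_apply]
    refine (Finset.sum_congr rfl fun h _ => ?_).trans (G.sum_left_eq_of_faceNext i.2 k)
    rw [← hp h]
  · intro ha
    obtain ⟨k, hk⟩ := G.exists_eq_sub_of_sum_left_eq_zero
      (z := fun h => G.edgeSign h *
        (G.extendZero a (G.left h) + G.extendZero a (G.left (G.opp h))))
      (fun h => by rw [edgeSign_opp, G.opp_opp]; ring)
      (fun F hF => by
        let i : G.InteriorFace := ⟨F, hF⟩
        exact (G.exchangeMatrix_mulVec a i).symm.trans (congrFun ha i))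
    exact ⟨(a, k), fun h => (hk h).symm, rfl⟩

/-- Compatible pairs with trivial face function are functions on the components of the graph. -/
theorem finrank_ker_fst_compatiblePairs :
    Module.finrank ℚ (LinearMap.ker
      ((LinearMap.fst ℚ (G.InteriorFace → ℚ) (G.Vertex → ℚ)).domRestrict G.compatiblePairs)) = G.numComponents := by
  have := G.finite_vertex
  rw [RibbonGraph.numComponents, RibbonGraph.Component, ← finrank_relInvariant]
  refine LinearEquiv.finrank_eq
    { toFun := fun p => ⟨p.1.1.2, ?_⟩
      map_add' := fun _ _ => rfl
      map_smul' := fun _ _ => rfl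
      invFun := fun k => ⟨⟨(0, k.1), ?_⟩, rfl⟩
      left_inv := ?_
      right_inv := fun _ => rfl }
  · rintro _ _ ⟨h, rfl, rfl⟩
    obtain ⟨⟨⟨a, k⟩, hp⟩, ha⟩ := p
    have ha : a = 0 := ha
    subst ha
    have := hp h
    simp only [map_zero, Pi.zero_apply, add_zero, mul_zero] at this
    exact (sub_eq_zero.1 this).symm
  · intro h
    simp only [map_zero, Pi.zero_apply, add_zero, mul_zero]
    exact sub_eq_zero.2 (k.2 _ _ ⟨h, rfl, rfl⟩).symm
  · rintro ⟨⟨⟨a, k⟩, hp⟩, ha⟩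
    have ha : a = 0 := ha
    subst ha
    rfl

/-! ### Compatible pairs and functions on strands. -/

/-- The function on the strands that belongs to a compatible pair. -/
noncomputable def strandFunction :
    ((G.InteriorFace → ℚ) × (G.Vertex → ℚ)) →ₗ[ℚ] (G.H → ℚ) where
  toFun p h := p.2 (G.src (G.opp h)) + G.extendZero p.1 (G.left (G.opp h))
    - G.whiteIndicator (G.src (G.opp h)) *
      (G.extendZero p.1 (G.left h) + G.extendZero p.1 (G.left (G.opp h)))
  map_add' p q := by
    ext h
    simp only [Prod.fst_add, Prod.snd_add, map_add, Pi.add_apply]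
    ring
  map_smul' c p := by
    ext h
    simp only [Prod.smul_fst, Prod.smul_snd, map_smul, Pi.smul_apply, smul_eq_mul,
      RingHom.id_apply]
    ring

theorem strandFunction_apply (p : (G.InteriorFace → ℚ) × (G.Vertex → ℚ)) (h : G.H) :
    G.strandFunction p h = p.2 (G.src (G.opp h)) + G.extendZero p.1 (G.left (G.opp h))
    - G.whiteIndicator (G.src (G.opp h)) *
      (G.extendZero p.1 (G.left h) + G.extendZero p.1 (G.left (G.opp h))) := rfl

/-- Compatibility says that `k - whiteIndicator * (a(left) + a(right))` has the same value at both
ends of an edge, so only the face terms differ. -/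
theorem strandFunction_opp_sub {p : (G.InteriorFace → ℚ) × (G.Vertex → ℚ)}
    (hp : p ∈ G.compatiblePairs) (h : G.H) :
    G.strandFunction p (G.opp h) - G.strandFunction p h
      = G.extendZero p.1 (G.left h) - G.extendZero p.1 (G.left (G.opp h)) := by
  have e := hp h
  rw [edgeSign] at e
  rw [strandFunction_apply, strandFunction_apply, G.opp_opp]
  linear_combination -e

/-- Without jumps, `a` is equal on both sides of every edge, hence zero since each component touches
a boundary face; then only `k` is left in the formula. -/
theorem strandFunction_injOn {p : (G.InteriorFace → ℚ) × (G.Vertex → ℚ)}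
    (hp : p ∈ G.compatiblePairs) (h0 : G.strandFunction p = 0) : p = 0 := by
  have ha : ∀ F, G.extendZero p.1 F = 0 :=
    G.eq_zero_of_left_eq_left_opp (fun F hF => G.extendZero_of_isBoundaryFace _ hF) (fun h => by
      have := G.strandFunction_opp_sub hp h
      rw [h0, Pi.zero_apply, Pi.zero_apply, sub_zero] at this
      exact (sub_eq_zero.1 this.symm))
  refine Prod.ext ?_ ?_
  · ext F
    rw [← G.extendZero_coe p.1 F, ha]
    rfl
  · ext v
    obtain ⟨h, rfl⟩ := G.src_surjective v
    have := congrFun h0 (G.opp h)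
    rw [strandFunction_apply, ha, ha, G.opp_opp, Pi.zero_apply] at this
    simpa using this

/-- Both sides of a boundary edge are boundary faces. -/
theorem extendZero_of_src_eq_inr (a : G.InteriorFace → ℚ) {h : G.H} {i : Fin G.N}
    (hi : G.src h = Sum.inr i) :
    G.extendZero a (G.left h) = 0 ∧ G.extendZero a (G.left (G.opp h)) = 0 :=
  ⟨G.extendZero_of_isBoundaryFace _ (G.isBoundaryFace_left hi),
    G.extendZero_of_isBoundaryFace _ (G.isBoundaryFace_left_opp hi)⟩

theorem extendZero_left_rot (a : G.InteriorFace → ℚ) (h : G.H) :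
    G.extendZero a (G.left (G.rot h)) = G.extendZero a (G.left (G.opp h)) := by
  rcases hs : G.src h with v | i
  · rw [G.left_rot_of_src_eq_inl hs]
  · rw [G.rot_of_src_eq_inr hs, (G.extendZero_of_src_eq_inr a hs).1,
      (G.extendZero_of_src_eq_inr a hs).2]

/-- By compatibility the value on the next edge can be read at its start, the vertex of the turn.
There it is `k - a(left)` or `k + a(right)`, and the turn preserves the face concerned. -/
theorem strandFunction_strandNext {p : (G.InteriorFace → ℚ) × (G.Vertex → ℚ)}
    (hp : p ∈ G.compatiblePairs) (h : G.H) :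
    G.strandFunction p (G.strandNext h) = G.strandFunction p h := by
  have e := hp (G.strandNext h)
  rw [edgeSign, G.src_strandNext] at e
  have hl : G.whiteIndicator (G.src (G.opp h)) = 1 ∧
      G.extendZero p.1 (G.left (G.strandNext h)) = G.extendZero p.1 (G.left h) ∨
      G.whiteIndicator (G.src (G.opp h)) = 0 ∧
      G.extendZero p.1 (G.left (G.opp (G.strandNext h))) = G.extendZero p.1 (G.left (G.opp h)) := by
    rcases G.strandNext_cases h with ⟨hw, hn⟩ | ⟨hw, hn, -⟩
    · exact Or.inl ⟨hw, by rw [hn, extendZero_left_rot, G.opp_opp]⟩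
    · exact Or.inr ⟨hw, by rw [hn, ← extendZero_left_rot, Equiv.apply_symm_apply]⟩
  rw [strandFunction_apply, strandFunction_apply]
  rcases hl with ⟨hw, hl⟩ | ⟨hw, hl⟩
  · rw [hw] at e ⊢
    rw [hl] at e ⊢
    linear_combination e
  · rw [hw] at e ⊢
    rw [hl] at e ⊢
    linear_combination e

/-- A function on the strands comes from a compatible pair: its jump across each edge is a flow. -/
theorem exists_strandFunction_eq {q : G.H → ℚ} (hq : ∀ h, q (G.strandNext h) = q h) :
    ∃ p ∈ G.compatiblePairs, G.strandFunction p = q := by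
  have := G.finite_H
  have := Fintype.ofFinite G.H
  obtain ⟨b, hb, hx⟩ := G.exists_face_function_of_flow (fun h => q (G.opp h) - q h)
    (fun h => by rw [G.opp_opp]; ring) (fun k => by
      simp only [mul_sub, Finset.sum_sub_distrib]
      -- Conservation: each strand that enters a vertex leaves it with the same value.
      rw [sub_eq_zero, eq_comm, ← G.strandNext_bijective.sum_comp, ← G.sum_opp]
      refine Finset.sum_congr rfl fun h _ => ?_
      rw [hq, G.src_strandNext, G.opp_opp])
  obtain ⟨a, rfl⟩ := G.exists_extendZero_eq hb
  set b := G.extendZero a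
  -- The formula for `strandFunction` on `opp h`, solved for `k` at the start of `h`; it remains to
  -- see that it is independent of `h` around the vertex.
  obtain ⟨k, hk⟩ := G.exists_eq_comp_src (fun h => q (G.opp h) - b (G.left h)
      + G.whiteIndicator (G.src h) * (b (G.left h) + b (G.left (G.opp h)))) (fun h => by
    have e1 := hx h
    have e2 := hx (G.rot h)
    have e3 : b (G.left (G.rot h)) = b (G.left (G.opp h)) := G.extendZero_left_rot a h
    rw [G.src_rot, e3]
    rw [e3] at e2
    -- At a white or boundary vertex the strand arriving along `opp h` leaves along `rot h`; at a
    -- black one the strand arriving along `opp (rot h)` leaves along `h`.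
    rcases G.strandNext_cases (G.opp h) with ⟨hw, hn⟩ | ⟨hw, hn, -⟩
    · have e4 := hq (G.opp h)
      rw [G.opp_opp] at hw hn
      rw [hn] at e4
      rw [hw]
      linear_combination e2 + e4
    · rw [G.opp_opp] at hw
      have hn : G.strandNext (G.opp (G.rot h)) = h := by
        rcases G.strandNext_cases (G.opp (G.rot h)) with ⟨hw', -⟩ | ⟨-, hn, -⟩
        · rw [G.opp_opp, G.src_rot, hw] at hw'
          exact absurd hw' zero_ne_one
        · rw [hn, G.opp_opp, Equiv.symm_apply_apply]
      have e4 := hq (G.opp (G.rot h))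
      rw [hn] at e4
      rw [hw]
      linear_combination -e4 - e1)
  refine ⟨(a, k), fun h => ?_, ?_⟩
  · have e := hx h
    dsimp only
    rw [← hk, ← hk, G.opp_opp, edgeSign]
    linear_combination -e
  · ext h
    rw [strandFunction_apply]
    dsimp only
    rw [← hk, G.opp_opp]
    ring

theorem finrank_compatiblePairs :
    Module.finrank ℚ G.compatiblePairs = Nat.card (Quot (fun a b : G.H => b = G.strandNext a)) := by
  have := G.finite_H
  rw [← finrank_relInvariant]
  have hinj : Function.Injective (G.strandFunction.domRestrict G.compatiblePairs) := by
    rw [injective_iff_map_eq_zero]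
    rintro ⟨p, hp⟩ h0
    exact Subtype.ext (G.strandFunction_injOn hp h0)
  rw [← LinearMap.finrank_range_of_inj hinj, LinearMap.range_domRestrict]
  suffices e : G.compatiblePairs.map G.strandFunction
      = relInvariant (fun a b : G.H => b = G.strandNext a) by rw [e]
  ext q
  rw [RibbonGraph.mem_relInvariant_fun]
  constructor
  · rintro ⟨p, hp, rfl⟩
    exact G.strandFunction_strandNext hp
  · exact fun hq => G.exists_strandFunction_eq hq

theorem numComponents_add_quiverCorank :
    G.numComponents + quiverCorank G.InteriorFace
      = Nat.card (Quot (fun a b : G.H => b = G.strandNext a)) := by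
  have := G.finite_vertex
  rw [← finrank_compatiblePairs, quiverCorank]
  let := Fintype.ofFinite G.InteriorFace
  rw [← ((LinearMap.fst ℚ (G.InteriorFace → ℚ) (G.Vertex → ℚ)).domRestrict
      G.compatiblePairs).finrank_range_add_finrank_ker, LinearMap.range_domRestrict,
    map_fst_compatiblePairs, finrank_ker_fst_compatiblePairs]
  have h1 := (exchangeMatrix G.InteriorFace).mulVecLin.finrank_range_add_finrank_ker
  rw [Module.finrank_fintype_fun_eq_card, ← Nat.card_eq_fintype_card] at h1
  rw [Matrix.rank, ← h1]
  omega

end PlabicGraph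

/-! ### Components of the link. -/

namespace StrandDivide

variable {G : PlabicGraph} (D : StrandDivide G)

theorem continuousOn_lift (h : G.H) : ContinuousOn (D.lift h) (Set.Icc 0 1) := by
  have hp : ContinuousOn (D.pos h) (Set.Icc 0 1) := fun t ht =>
    (D.hasDeriv h t ht).continuousWithinAt
  have hv := D.continuous_vel h
  refine hp.prodMk (ContinuousOn.smul (ContinuousOn.div ?_ hv.norm ?_) hv)
  · exact (continuousOn_const.sub (hp.norm.pow 2)).sqrt
  · exact fun t ht => norm_ne_zero_iff.2 (D.vel_ne_zero h t ht)

theorem lift_one (h : G.H) : D.lift h 1 = D.lift (G.strandNext h) 0 := by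
  have h1 := D.vel_ne_zero h 1 (by simp)
  have h0 := D.vel_ne_zero (G.strandNext h) 0 (by simp)
  have e := (D.vel_one h).inv_norm_smul_eq h1 h0
  simp only [lift, div_eq_mul_inv, mul_smul, D.pos_one, e]

/-- The final point of an arc is assigned to the next arc, so that `transversal`, stated on `[0,
1)`, applies. -/
theorem exists_lift_eq (h : G.H) {t : ℝ} (ht : t ∈ Set.Icc (0 : ℝ) 1) :
    ∃ h' : G.H, (Quot.mk (fun a b : G.H => b = G.strandNext a) h' = Quot.mk _ h) ∧
      ∃ s ∈ Set.Ico (0 : ℝ) 1, D.lift h t = D.lift h' s := by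
  rcases ht.2.lt_or_eq with h1 | rfl
  · exact ⟨h, rfl, t, ⟨ht.1, h1⟩, rfl⟩
  · exact ⟨G.strandNext h, (Quot.sound (r := fun a b : G.H => b = G.strandNext a) rfl).symm,
      0, by simp, D.lift_one h⟩

/-- A common lift of two arcs would lie over a double point inside the open disk, where the radius
of the fibre circle is positive; the two tangents would then be proportional. -/
theorem eq_of_lift_eq {h h' : G.H} {s t : ℝ} (hs : s ∈ Set.Ico (0 : ℝ) 1)
    (ht : t ∈ Set.Ico (0 : ℝ) 1) (e : D.lift h s = D.lift h' t) : h = h' := by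
  by_contra hne
  have e1 : D.pos h s = D.pos h' t := congrArg Prod.fst e
  have e2 : (Real.sqrt (1 - ‖D.pos h s‖ ^ 2) / ‖D.vel h s‖) • D.vel h s
    = (Real.sqrt (1 - ‖D.pos h' t‖ ^ 2) / ‖D.vel h' t‖) • D.vel h' t := congrArg Prod.snd e
  obtain ⟨hlt, hli⟩ := D.transversal h h' s hs t ht (fun e => hne (congrArg Prod.fst e)) e1
  have hsq : 0 < Real.sqrt (1 - ‖D.pos h s‖ ^ 2) := by
    apply Real.sqrt_pos.2
    have := norm_nonneg (D.pos h s)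
    nlinarith
  have hv := norm_pos_iff.2 (D.vel_ne_zero h s (Set.Ico_subset_Icc_self hs))
  rw [LinearIndependent.pair_iff] at hli
  have := (hli _ (-(Real.sqrt (1 - ‖D.pos h' t‖ ^ 2) / ‖D.vel h' t‖)) (by
    rw [e2, neg_smul, add_neg_cancel])).1
  exact (div_pos hsq hv).ne' this

/-- The set of closed strands. -/
abbrev Strand (G : PlabicGraph) : Type := Quot (fun a b : G.H => b = G.strandNext a)

theorem strand_eq_of_lift_eq {h h' : G.H} {s t : ℝ} (hs : s ∈ Set.Icc (0 : ℝ) 1)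
    (ht : t ∈ Set.Icc (0 : ℝ) 1) (e : D.lift h s = D.lift h' t) :
    (Quot.mk _ h : Strand G) = Quot.mk _ h' := by
  obtain ⟨g, hg, s', hs', e1⟩ := D.exists_lift_eq h hs
  obtain ⟨g', hg', t', ht', e2⟩ := D.exists_lift_eq h' ht
  rw [← hg, ← hg', D.eq_of_lift_eq hs' ht' (e1.symm.trans (e.trans e2))]

/-- The point of the link over a point of the divide. -/
noncomputable def linkPoint (h : G.H) (t : Set.Icc (0 : ℝ) 1) : D.link :=
  ⟨D.lift h t, h, t, t.2, rfl⟩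

theorem continuous_linkPoint (h : G.H) : Continuous (D.linkPoint h) :=
  (continuousOn_iff_continuous_domRestrict.1 (D.continuousOn_lift h)).subtype_mk _

/-- The strand that carries a point of the link. -/
noncomputable def strandOf (p : D.link) : Strand G := Quot.mk _ p.2.choose

theorem strandOf_linkPoint (h : G.H) (t : Set.Icc (0 : ℝ) 1) :
    D.strandOf (D.linkPoint h t) = Quot.mk _ h := by
  obtain ⟨s, hs, e⟩ := (D.linkPoint h t).2.choose_spec
  exact D.strand_eq_of_lift_eq hs t.2 e.symm

theorem exists_eq_linkPoint (p : D.link) : ∃ h t, p = D.linkPoint h t := by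
  obtain ⟨p, h, t, ht, e⟩ := p
  exact ⟨h, ⟨t, ht⟩, Subtype.ext e⟩

/-- Such a preimage is a finite union of compact arcs. Hence `strandOf` is continuous into the
discrete set of strands and separates components. -/
theorem isClosed_preimage_strandOf (S : Set (Strand G)) : IsClosed (D.strandOf ⁻¹' S) := by
  have := G.finite_H
  have : D.strandOf ⁻¹' S
      = ⋃ h ∈ {h : G.H | (Quot.mk _ h : Strand G) ∈ S}, Set.range (D.linkPoint h) := by
    ext p
    obtain ⟨h, t, rfl⟩ := D.exists_eq_linkPoint p
    simp only [Set.mem_preimage, strandOf_linkPoint, Set.mem_iUnion, Set.mem_ofPred_eq,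
      Set.mem_range, exists_prop]
    constructor
    · exact fun hS => ⟨h, hS, t, rfl⟩
    · rintro ⟨h', hS, t', e⟩
      rwa [← D.strandOf_linkPoint h t, ← e, strandOf_linkPoint]
  rw [this]
  exact (Set.toFinite _).isClosed_biUnion fun h _ =>
    (isCompact_range (D.continuous_linkPoint h)).isClosed

theorem coe_linkPoint_eq (h : G.H) (s t : Set.Icc (0 : ℝ) 1) :
    (D.linkPoint h s : ConnectedComponents D.link) = D.linkPoint h t :=
  ConnectedComponents.coe_eq_coe'.2
    ((isPreconnected_range (D.continuous_linkPoint h)).subset_connectedComponent ⟨t, rfl⟩ ⟨s, rfl⟩)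

/-- The component of the link that lies over a strand. -/
noncomputable def strandComponent : Strand G → ConnectedComponents D.link :=
  Quot.lift (fun h => (D.linkPoint h 0 : ConnectedComponents D.link)) (by
    rintro h _ rfl
    have : D.linkPoint (G.strandNext h) 0 = D.linkPoint h 1 := Subtype.ext (D.lift_one h).symm
    exact (D.coe_linkPoint_eq h 0 1).trans (congrArg _ this.symm))

theorem strandComponent_bijective : Function.Bijective D.strandComponent := by
  let : TopologicalSpace (Strand G) := ⊥
  have : DiscreteTopology (Strand G) := ⟨rfl⟩
  have hc : Continuous D.strandOf :=
    continuous_iff_isClosed.2 fun S _ => D.isClosed_preimage_strandOf S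
  constructor
  · refine Function.LeftInverse.injective (g := hc.connectedComponentsLift) ?_
    rintro ⟨h⟩
    exact D.strandOf_linkPoint h 0
  · intro C
    obtain ⟨p, rfl⟩ := ConnectedComponents.surjective_coe C
    obtain ⟨h, t, rfl⟩ := D.exists_eq_linkPoint p
    exact ⟨Quot.mk _ h, D.coe_linkPoint_eq h 0 t⟩

theorem numLinkComponents_eq : D.numLinkComponents = Nat.card (Strand G) :=
  (Nat.card_congr (Equiv.ofBijective _ D.strandComponent_bijective)).symm

end StrandDivide

theorem mainTheorem5 (G : PlabicGraph) (D : StrandDivide G) :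
    G.numComponents + quiverCorank G.InteriorFace = D.numLinkComponents := by
  rw [G.numComponents_add_quiverCorank, D.numLinkComponents_eq]
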